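/- **Setting.** Fix variables, values, operators with an interpretation on values, a set of boolean expressions containing the constant $\mathrm{True}$, and action labels. Expressions are values, variables and operator terms. Actions are $a(e_1,\dots,e_n)$; one constant action $\tau$ (arity 0) is the silent action. The signature of an action is its label with its arity. Predicates are considered up to logical equivalence, i.e. as sets of valuations; an equation $\alpha=\alpha'$ between actions means equal labels and equal argument values. **pNets.** A pLTS $\langle S,s_0,V,\to\rangle$ has states $S$, an initial state $s_0$, a set $V$ of variables, and transitions $s\xrightarrow{\langle\alpha,\,g,\,(x_j:=e_j)_j\rangle}s'$, where $\alpha=a(p_1,\dots,p_n)$, each $p_i$ is an input variable $?x$ (occurring in no other $p_k$) or an expression, $g$ is a boolean guard, and the $x_j:=e_j$ are simultaneous assignments; with $iv(\alpha)$ the input variables of $\alpha$, we require $\mathrm{vars}(\alpha)\setminus iv(\alpha)\subseteq V$, $\mathrm{vars}(g)\subseteq V\cup \mathrm{vars}(\alpha)$, $x_j\in V$ and $\mathrm{vars}(e_j)\subseteq V\cup iv(\alpha)$. A pNet is a pLTS or a node $\langle P_i^{i\in I},\mathrm{Sort}_j^{j\in J},SV\rangle$ with sub-pNets $P_i$, holes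 $J$ ($I\cap J=\emptyset$, $I\cup J\ne\emptyset$) with sorts $\mathrm{Sort}_j$ (sets of signatures), and a set $SV$ of synchronisation vectors $\langle \alpha_l^{l\in M}\rangle\to\alpha'[g]$, $M\subseteq I\cup J$, where the signature of $\alpha_l$ lies in the sort of $P_l$, resp. in $\mathrm{Sort}_l$, and the variables of $\alpha'$ and of the boolean guard $g$ occur in the $\alpha_l$. $\mathrm{Sort}(P)$ is the set of signatures of the actions on the transitions of a pLTS, resp. of the actions $\alpha'$ of the vectors of a node. The sub-pNets of a node have pairwise disjoint sets of variables and pairwise disjoint sets of holes (at all depths), and the latter are disjoint from $J$. For $j_0\in J$, $P[Q]_{j_0}$ is obtained by making $Q$ a sub-pNet with index $j_0$ and removing $j_0$ from $J$. A node *cannot observe silent actions* if $\langle l\mapsto\tau\rangle\to\tau[\mathrm{True}]$ is in $SV$ for every $l\in I\cup J$, and every vector $\langle \alpha_l^{l\in M}\rangle\to\alpha'[g]$ of $SV$ with $\alpha_l=\tau$ for some $l\in M\cap J$ has $\alpha'=\tau$ and $M=\{l\}$. **Semantics.** An open transition $s\to s'$ consists of an action $\beta_j$ (with signature in the sort of $j$)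 for each $j$ in a set $J'$ of holes, a predicate $\mathrm{Pred}$, a simultaneous assignment $\mathrm{Post}$ of variables, and a resulting action $\alpha$. The states of a pNet are the tuples of states of its leaves, and its open transitions $\mathcal T$ are the smallest set closed under: (i) a transition of a pLTS gives an open transition with $J'=\emptyset$, predicate $g$, effect $(x_j\gets e_j)_j$ and action $\alpha$ with the input markers removed; (ii) for a vector of a node with its variables instantiated (in particular by fresh variables), open transitions of the $P_i$, $i\in M\cap I$ (the other sub-pNets do not move), and actions $\beta_j$, $j\in M\cap J$, give an open transition whose predicate is the conjunction of those of the sub-pNets, of the guard, and of the equations between the actions of the sub-pNets, the $\beta_j$ and the resulting action and the corresponding actions of the vector; its hole actions are the $\beta_j$ together with those of the sub-pNets, and its effect is the union of their effects; (iii) substituting expressions for variables that are not variables of the pNet, and strengthening the predicate. Weak open transitions carry a list $\gamma_j$ of actions for each hole and are generated by: (1) the idle transition $s\to s$ labelled $\tau$ with no hole action, predicate $\mathrm{True}$ and identity effect; (2) every open transition, dropping the hole actions equal to $\tau$; (3) composites of three consecutive weak open transitions labelled $\tau$, $\alpha$, $\tau$ with effects $\mathrm{Post}_1,\mathrm{Post}_2,\mathrm{Post}_3$: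 predicates are conjoined and lists concatenated, after applying $\mathrm{Post}_1$ to those of the second and "$\mathrm{Post}_1$ then $\mathrm{Post}_2$" to those of the third; the label is $\alpha$ with $\mathrm{Post}_1$ applied, the effect is the sequential composition. A weak FH-bisimulation between two pNets (or open automata) with the same holes and hole sorts associates to each pair of states $(s,t)$ a predicate $\mathrm{Pred}_{s,t}$ over the variables of both (common names being renamed apart), such that for every open transition $(\beta_j^{j\in J'},\mathrm{Pred}_{OT},\mathrm{Post}_{OT},\alpha)$ from $s$ to $s'$ there is a family, indexed by a set $X$, of weak open transitions $(\gamma_{jx}^{j\in J_x},\mathrm{Pred}_{x},\mathrm{Post}_{x},\alpha_x)$ from $t$ to $t_x$ with $J_x=\{j\in J'\mid\beta_j\neq\tau\}$ and $$\mathrm{Pred}_{s,t}\wedge \mathrm{Pred}_{OT}\Rightarrow\bigvee_{x\in X}\Big(\forall j\in J_x.\ [\beta_j]=\gamma_{jx}\ \wedge\ \mathrm{Pred}_{x}\ \wedge\ \alpha=\alpha_x\ \wedge\ \mathrm{Pred}_{s',t_x}\{\mathrm{Post}_{OT}\uplus \mathrm{Post}_{x}\}\Big)$$ for all valuations, and symmetrically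 for the open transitions from $t$. Two pNets are weak FH-bisimilar if they have the same holes with the same sorts and there is a weak FH-bisimulation for which the predicate of the pair of initial states is true for all initial values of the variables (a variable name common to both pNets having the same initial value in both). **Theorem (Congruence for weak bisimulation).** Let $P=\langle P_i^{i\in I},\mathrm{Sort}_j^{j\in J},SV\rangle$ be an open pNet that cannot observe silent actions, and let $j_0\in J$ be a hole. Let $Q$ and $Q'$ be weak FH-bisimilar pNets with $\mathrm{Sort}(Q)=\mathrm{Sort}(Q')=\mathrm{Sort}_{j_0}$, such that $P[Q]_{j_0}$ and $P[Q']_{j_0}$ are pNets (i.e. variables and holes of $Q$ and of $Q'$ do not clash with those of the rest of $P$). Then $P[Q]_{j_0}$ and $P[Q']_{j_0}$ are weak FH-bisimilar. -/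

import Mathlib

/-! ## Terms, actions, valuations -/

universe u v w

/-- Data expressions: values, variables, and operators applied to expressions
(`Op n` is the set of operator symbols of arity `n`). -/
inductive Expr (Var Val : Type u) (Op : ℕ → Type u) : Type u where
  | val (c : Val) : Expr Var Val Op
  | var (x : Var) : Expr Var Val Op
  | op {n : ℕ} (o : Op n) (args : Fin n → Expr Var Val Op) : Expr Var Val Op

/-- The ambient term algebra: variables, values, operators with their interpretation, the
set of boolean expressions (a guard is satisfied when its value is `tru`), and
the action labels, with the label of the silent action. Nothing else is fixed about it. -/
structure TermAlgebra where
  Var : Type u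
  Val : Type u
  Op : ℕ → Type u
  Lab : Type u
  interp : {n : ℕ} → Op n → (Fin n → Val) → Val
  tru : Val
  IsBool : Expr Var Val Op → Prop
  isBool_tru : IsBool (Expr.val tru)
  tauLab : Lab

variable {𝔸 : TermAlgebra.{u}} {ι : Type w}

/-- Expressions of the algebra. -/
abbrev TermAlgebra.Exp (𝔸 : TermAlgebra.{u}) : Type u := Expr 𝔸.Var 𝔸.Val 𝔸.Op

/-- Valuations of the variables. -/
abbrev TermAlgebra.Valuation (𝔸 : TermAlgebra.{u}) : Type u := 𝔸.Var → 𝔸.Val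

/-- Substitutions; a variable that is not substituted is mapped to itself. -/
abbrev TermAlgebra.Subst (𝔸 : TermAlgebra.{u}) : Type u := 𝔸.Var → 𝔸.Exp

/-- Predicates modulo logical equivalence, that is, sets of valuations. -/
abbrev TermAlgebra.Predicate (𝔸 : TermAlgebra.{u}) : Type u := 𝔸.Valuation → Prop

/-- An action signature: a label and an arity. -/
abbrev TermAlgebra.Sig (𝔸 : TermAlgebra.{u}) : Type u := 𝔸.Lab × ℕ

namespace Expr

def eval (ρ : 𝔸.Valuation) : 𝔸.Exp → 𝔸.Val
  | .val c => c
  | .var x => ρ x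
  | .op o args => 𝔸.interp o fun i => eval ρ (args i)

/-- Simultaneous substitution. -/
def subst (σ : 𝔸.Subst) : 𝔸.Exp → 𝔸.Exp
  | .val c => .val c
  | .var x => σ x
  | .op o args => .op o fun i => subst σ (args i)

def vars : 𝔸.Exp → Set 𝔸.Var
  | .val _ => ∅
  | .var x => {x}
  | .op _ args => ⋃ i, vars (args i)

end Expr

/-- The valuation obtained from `ρ` by performing the simultaneous assignment `σ`. A predicate `p`
becomes, under the substitution `σ`, the predicate `fun ρ => p (σ.apply ρ)`. -/
def TermAlgebra.Subst.apply (σ : 𝔸.Subst) (ρ : 𝔸.Valuation) : 𝔸.Valuation :=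
  fun x => (σ x).eval ρ

/-- Composition of effects, `τ` being performed first and `σ` second:
`x ↦ (σ x)` with `τ` applied to it. -/
def TermAlgebra.Subst.comp (σ τ : 𝔸.Subst) : 𝔸.Subst :=
  fun x => (σ x).subst τ

/-- Actions `a(e₁, …, eₙ)`, without input markers. -/
@[ext]
structure Act (𝔸 : TermAlgebra.{u}) where
  lab : 𝔸.Lab
  args : List 𝔸.Exp

namespace Act

/-- The silent action. -/
def tau (𝔸 : TermAlgebra.{u}) : Act 𝔸 := ⟨𝔸.tauLab, []⟩

def sig (a : Act 𝔸) : 𝔸.Sig := (a.lab, a.args.length)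

def vars (a : Act 𝔸) : Set 𝔸.Var := {x | ∃ e ∈ a.args, x ∈ e.vars}

def subst (σ : 𝔸.Subst) (a : Act 𝔸) : Act 𝔸 := ⟨a.lab, a.args.map (Expr.subst σ)⟩

/-- The value of an action. The formula `a = b` between two action terms holds under `ρ` when
`a.eval ρ = b.eval ρ`. -/
def eval (ρ : 𝔸.Valuation) (a : Act 𝔸) : 𝔸.Lab × List 𝔸.Val :=
  (a.lab, a.args.map (Expr.eval ρ))

theorem sig_subst (σ : 𝔸.Subst) (a : Act 𝔸) : (a.subst σ).sig = a.sig := by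
  simp [sig, subst]

end Act

/-- A parameter of an action of a pLTS: an input variable `?x` or an expression. -/
inductive Param (𝔸 : TermAlgebra.{u}) : Type u where
  | input (x : 𝔸.Var) : Param 𝔸
  | expr (e : 𝔸.Exp) : Param 𝔸

/-- The expression obtained by removing the input marker. -/
def Param.toExp : Param 𝔸 → 𝔸.Exp
  | .input x => .var x
  | .expr e => e

/-- Actions `a(p₁, …, pₙ)` with input variables. An input variable occurs in no
other parameter of the same action. -/
structure InAct (𝔸 : TermAlgebra.{u}) where
  lab : 𝔸.Lab
  params : List (Param 𝔸)
  linear : ∀ (i j : Fin params.length) (x : 𝔸.Var),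
    params.get i = .input x → j ≠ i → x ∉ (params.get j).toExp.vars

namespace InAct

/-- Removal of the input markers. -/
def toAct (a : InAct 𝔸) : Act 𝔸 := ⟨a.lab, a.params.map Param.toExp⟩

/-- The input variables. -/
def iv (a : InAct 𝔸) : Set 𝔸.Var := {x | Param.input x ∈ a.params}

end InAct

/-! ## Parameterised networks -/

/-- Parameterised labelled transition systems. `step s α g asg s'` is a transition from `s` to `s'`
with action `α`, guard `g`, and the simultaneous assignments `x := e` for `asg x = some e`. -/
structure PLTS (𝔸 : TermAlgebra.{u}) where
  State : Type v
  init : State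
  V : Set 𝔸.Var
  step : State → InAct 𝔸 → 𝔸.Exp → (𝔸.Var → Option 𝔸.Exp) → State → Prop
  act_vars : ∀ {s α g asg s'}, step s α g asg s' → α.toAct.vars \ α.iv ⊆ V
  guard_bool : ∀ {s α g asg s'}, step s α g asg s' → 𝔸.IsBool g
  guard_vars : ∀ {s α g asg s'}, step s α g asg s' → g.vars ⊆ V ∪ α.toAct.vars
  asg_vars : ∀ {s α g asg s'}, step s α g asg s' →
    ∀ x e, asg x = some e → x ∈ V ∧ e.vars ⊆ V ∪ α.iv

/-- Synchronisation vectors `⟨α_l, l ∈ M⟩ → res [guard]`, where `M` is the set of the indices `l`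
with `act l ≠ none`. -/
structure SyncVector (𝔸 : TermAlgebra.{u}) (ι : Type w) where
  act : ι → Option (Act 𝔸)
  res : Act 𝔸
  guard : 𝔸.Exp

/-- pNets. A leaf is a pLTS. A node has
* a family `sub` of sub-pNets; `name i : ι` is the index under which the synchronisation vectors
  refer to `sub i`, so that the index set of the family is `Set.range name`;
* a set `J` of holes with their sorts (only the values `sort j` with `j ∈ J` matter);
* a set `SV` of synchronisation vectors.
The conditions that a pNet satisfies are collected in `PNet.WF`. -/
inductive PNet (𝔸 : TermAlgebra.{u}) (ι : Type w) : Type (max u w (v + 1)) where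
  | leaf (L : PLTS.{u, v} 𝔸) : PNet 𝔸 ι
  | node (I : Type v) (name : I → ι) (sub : I → PNet 𝔸 ι) (J : Set ι) (sort : ι → Set 𝔸.Sig)
      (SV : Set (SyncVector 𝔸 ι)) : PNet 𝔸 ι

namespace PNet

/-- The sort of a pNet: the signatures of the actions that it exposes. -/
def outSort : PNet.{u, v, w} 𝔸 ι → Set 𝔸.Sig
  | leaf L => {sg | ∃ s α g asg s', L.step s α g asg s' ∧ α.toAct.sig = sg}
  | node _ _ _ _ _ SV => {sg | ∃ V ∈ SV, V.res.sig = sg}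

/-- All variables of the pLTSs of a pNet. -/
def vars : PNet.{u, v, w} 𝔸 ι → Set 𝔸.Var
  | leaf L => L.V
  | node _ _ sub _ _ _ => ⋃ i, vars (sub i)

/-- All holes of a pNet, at any depth. -/
def holes : PNet.{u, v, w} 𝔸 ι → Set ι
  | leaf _ => ∅
  | node _ _ sub J _ _ => J ∪ ⋃ i, holes (sub i)

/-- The sort of each hole, at any depth. -/
def holeSort : PNet.{u, v, w} 𝔸 ι → ι → Set 𝔸.Sig
  | leaf _ => fun _ => ∅
  | node _ _ sub J sort _ => fun j =>
      {sg | (j ∈ J ∧ sg ∈ sort j) ∨ ∃ i, j ∈ holes (sub i) ∧ sg ∈ holeSort (sub i) j}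

/-- The holes that belong to the root of a pNet. -/
def rootHoles : PNet.{u, v, w} 𝔸 ι → Set ι
  | leaf _ => ∅
  | node _ _ _ J _ _ => J

/-- The well-formedness conditions of pNets. -/
def WF : PNet.{u, v, w} 𝔸 ι → Prop
  | leaf _ => True
  | node I name sub J sort SV =>
      (∀ i, WF (sub i)) ∧
      Function.Injective name ∧
      Disjoint (Set.range name) J ∧
      (Set.range name ∪ J).Nonempty ∧
      (∀ i i', i ≠ i' → Disjoint (vars (sub i)) (vars (sub i'))) ∧
      (∀ i i', i ≠ i' → Disjoint (holes (sub i)) (holes (sub i'))) ∧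
      (∀ i, Disjoint (holes (sub i)) J) ∧
      ∀ V ∈ SV,
        (∀ l a, V.act l = some a →
          (∃ i : I, name i = l ∧ a.sig ∈ outSort (sub i)) ∨ (l ∈ J ∧ a.sig ∈ sort l)) ∧
        (∀ x ∈ V.res.vars, ∃ l a, V.act l = some a ∧ x ∈ a.vars) ∧
        𝔸.IsBool V.guard ∧
        (∀ x ∈ V.guard.vars, ∃ l a, V.act l = some a ∧ x ∈ a.vars)

/-- `P.fill j₀ Q` is `P[Q]_{j₀}`: the hole `j₀` of the root of `P` becomes a sub-pNet `Q` with the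
same index. -/
def fill : PNet.{u, v, w} 𝔸 ι → ι → PNet.{u, v, w} 𝔸 ι → PNet.{u, v, w} 𝔸 ι
  | leaf L, _, _ => leaf L
  | node I name sub J sort SV, j₀, Q =>
      node (Option I) (fun o => o.elim j₀ name) (fun o => o.elim Q sub) (J \ {j₀}) sort SV

/-- Non-observability of silent actions: every sub-pNet and every hole may perform a silent action
alone, which results in a silent action, and a vector that involves a silent action of a
hole is silent and involves nothing else. -/
def CannotObserveSilent : PNet.{u, v, w} 𝔸 ι → Prop
  | leaf _ => True
  | node _ name _ J _ SV =>
      (∀ l ∈ Set.range name ∪ J, ∃ V ∈ SV,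
        V.act l = some (Act.tau 𝔸) ∧ (∀ l', l' ≠ l → V.act l' = none) ∧
        V.res = Act.tau 𝔸 ∧ V.guard = Expr.val 𝔸.tru) ∧
      ∀ V ∈ SV, ∀ l ∈ J, V.act l = some (Act.tau 𝔸) →
        V.res = Act.tau 𝔸 ∧ ∀ l', l' ≠ l → V.act l' = none

/-- States: tuples of states of the leaves. -/
def State : PNet.{u, v, w} 𝔸 ι → Type v
  | leaf L => L.State
  | node I _ sub _ _ _ => (i : I) → State (sub i)

def initState : (P : PNet.{u, v, w} 𝔸 ι) → P.State
  | leaf L => L.init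
  | node _ _ sub _ _ _ => fun i => initState (sub i)

end PNet

/-! ## Open automata -/

/-- Open transitions with states in `S`. The holes involved are the indices `j` with
`act j ≠ none`; `post` is the effect on the variables, a variable that is not assigned being mapped
to itself. -/
@[ext]
structure OpenTransition (𝔸 : TermAlgebra.{u}) (ι : Type w) (S : Type v) where
  act : ι → Option (Act 𝔸)
  pred : 𝔸.Predicate
  post : 𝔸.Subst
  src : S
  lab : Act 𝔸
  tgt : S

open Classical in
/-- The refinement of an open transition of an automaton with variables `V` by a substitution `σ`
of variables outside `V` and by a predicate `p`. -/
noncomputable def OpenTransition.refine {S : Type v} (V : Set 𝔸.Var) (σ : 𝔸.Subst)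
    (p : 𝔸.Predicate) (t : OpenTransition 𝔸 ι S) : OpenTransition 𝔸 ι S where
  act := fun j => (t.act j).map (Act.subst σ)
  pred := fun ρ => t.pred (σ.apply ρ) ∧ p ρ
  post := fun x => if x ∈ V then (t.post x).subst σ else .var x
  src := t.src
  lab := t.lab.subst σ
  tgt := t.tgt

/-- The closure of a set of open transitions under refinement. -/
inductive Saturate {S : Type v} (V : Set 𝔸.Var) (G : Set (OpenTransition 𝔸 ι S)) :
    OpenTransition 𝔸 ι S → Prop where
  | base {t} (h : t ∈ G) : Saturate V G t
  | refine {t} (h : Saturate V G t) (σ : 𝔸.Subst) (hσ : ∀ x ∈ V, σ x = .var x)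
      (p : 𝔸.Predicate) : Saturate V G (t.refine V σ p)

/-- Open automata. -/
structure OpenAutomaton (𝔸 : TermAlgebra.{u}) (ι : Type w) where
  holes : Set ι
  sort : ι → Set 𝔸.Sig
  State : Type v
  init : State
  vars : Set 𝔸.Var
  trans : Set (OpenTransition 𝔸 ι State)
  act_mem : ∀ t ∈ trans, ∀ j b, t.act j = some b → j ∈ holes ∧ b.sig ∈ sort j
  post_id : ∀ t ∈ trans, ∀ x ∉ vars, t.post x = .var x
  closed : ∀ t ∈ trans, ∀ σ : 𝔸.Subst, (∀ x ∈ vars, σ x = .var x) → ∀ p : 𝔸.Predicate,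
    t.refine vars σ p ∈ trans

namespace PNet

/-- The open transitions of a pLTS. -/
inductive LeafRule (L : PLTS.{u, v} 𝔸) : OpenTransition 𝔸 ι L.State → Prop where
  | mk {s α g asg s'} (h : L.step s α g asg s') : LeafRule L
      { act := fun _ => none
        pred := fun ρ => g.eval ρ = 𝔸.tru
        post := fun x => (asg x).getD (.var x)
        src := s
        lab := α.toAct
        tgt := s' }

/-- The open transitions of a pNet node, given the sets `T i` of open transitions of the
sub-pNets. The transition `t` is obtained from the vector `V`, the substitution `σ` which
instantiates the variables of the vector, and one transition `r i` of each sub-pNet `sub i` that is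
involved in `V`. No freshness condition on the variables of `V`, of `t.act` and of `t.lab` is
imposed: every instance of the rule with fresh variables is covered, and the other instances are
refinements of those. -/
def NodeRule {I : Type v} (name : I → ι) (sub : I → PNet.{u, v, w} 𝔸 ι) (J : Set ι)
    (sort : ι → Set 𝔸.Sig) (SV : Set (SyncVector 𝔸 ι))
    (T : (i : I) → Set (OpenTransition 𝔸 ι (sub i).State))
    (t : OpenTransition 𝔸 ι ((i : I) → (sub i).State)) : Prop :=
  ∃ V ∈ SV, ∃ (σ : 𝔸.Subst) (r : (i : I) → OpenTransition 𝔸 ι (sub i).State),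
    -- the sub-pNets that are involved move, the others do not
    (∀ i, V.act (name i) ≠ none → r i ∈ T i ∧ (r i).src = t.src i ∧ (r i).tgt = t.tgt i) ∧
    (∀ i, V.act (name i) = none → t.tgt i = t.src i) ∧
    -- actions of the holes of the node, then of the holes of the sub-pNets
    (∀ j ∈ J, V.act j = none → t.act j = none) ∧
    (∀ j ∈ J, V.act j ≠ none → ∃ b, t.act j = some b ∧ b.sig ∈ sort j) ∧
    (∀ i, V.act (name i) ≠ none → ∀ j ∈ (sub i).holes, t.act j = (r i).act j) ∧
    (∀ i, V.act (name i) = none → ∀ j ∈ (sub i).holes, t.act j = none) ∧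
    (∀ j, j ∉ J → (∀ i, j ∉ (sub i).holes) → t.act j = none) ∧
    -- predicate
    (t.pred = fun ρ =>
      (∀ i, V.act (name i) ≠ none → (r i).pred ρ) ∧
      (∀ i a, V.act (name i) = some a → (r i).lab.eval ρ = (a.subst σ).eval ρ) ∧
      (∀ j ∈ J, ∀ a b, V.act j = some a → t.act j = some b → b.eval ρ = (a.subst σ).eval ρ) ∧
      t.lab.eval ρ = (V.res.subst σ).eval ρ ∧
      (V.guard.subst σ).eval ρ = 𝔸.tru) ∧
    -- effect: the disjoint union of the effects of the sub-pNets that move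
    (∀ i, V.act (name i) ≠ none → ∀ x ∈ (sub i).vars, t.post x = (r i).post x) ∧
    (∀ x, (∀ i, V.act (name i) ≠ none → x ∉ (sub i).vars) → t.post x = .var x)

/-- The open transitions of a pNet. -/
def trans : (P : PNet.{u, v, w} 𝔸 ι) → Set (OpenTransition 𝔸 ι P.State)
  | leaf L => {t | Saturate (leaf (ι := ι) L).vars {t | LeafRule L t} t}
  | node I name sub J sort SV =>
      {t | Saturate (node I name sub J sort SV).vars
        {t | NodeRule name sub J sort SV (fun i => trans (sub i)) t} t}

theorem saturate_act_mem {S : Type v} {V : Set 𝔸.Var} {G : Set (OpenTransition 𝔸 ι S)}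
    {H : Set ι} {sort : ι → Set 𝔸.Sig}
    (hG : ∀ t ∈ G, ∀ j b, t.act j = some b → j ∈ H ∧ b.sig ∈ sort j)
    {t : OpenTransition 𝔸 ι S} (ht : Saturate V G t) :
    ∀ j b, t.act j = some b → j ∈ H ∧ b.sig ∈ sort j := by
  induction ht with
  | base h => exact hG _ h
  | refine h σ hσ p ih =>
    intro j b hb
    simp only [OpenTransition.refine, Option.map_eq_some_iff] at hb
    obtain ⟨a, ha, rfl⟩ := hb
    rw [Act.sig_subst]
    exact ih j a ha

theorem saturate_post_id {S : Type v} {V : Set 𝔸.Var} {G : Set (OpenTransition 𝔸 ι S)}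
    (hG : ∀ t ∈ G, ∀ x ∉ V, t.post x = .var x)
    {t : OpenTransition 𝔸 ι S} (ht : Saturate V G t) : ∀ x ∉ V, t.post x = .var x := by
  induction ht with
  | base h => exact hG _ h
  | refine h σ hσ p ih =>
    intro x hx
    simp [OpenTransition.refine, hx]

theorem trans_act_mem (P : PNet.{u, v, w} 𝔸 ι) :
    ∀ t ∈ P.trans, ∀ j b, t.act j = some b → j ∈ P.holes ∧ b.sig ∈ P.holeSort j := by
  induction P with
  | leaf L =>
    intro t ht
    refine saturate_act_mem ?_ ht
    rintro _ ⟨h⟩ j b hb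
    simp at hb
  | node I name sub J sort SV ih =>
    intro t ht
    refine saturate_act_mem ?_ ht
    rintro t ⟨V, -, σ, r, hr, -, h1, h2, h3, h4, h5, -, -, -⟩ j b hb
    by_cases hj : j ∈ J
    · by_cases hV : V.act j = none
      · rw [h1 j hj hV] at hb
        cases hb
      · obtain ⟨b', hb', hs⟩ := h2 j hj hV
        rw [hb'] at hb
        cases hb
        exact ⟨Or.inl hj, Or.inl ⟨hj, hs⟩⟩
    · by_cases hi : ∃ i, j ∈ (sub i).holes
      · obtain ⟨i, hi⟩ := hi
        by_cases hV : V.act (name i) = none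
        · rw [h4 i hV j hi] at hb
          cases hb
        · rw [h3 i hV j hi] at hb
          have := ih i (r i) (hr i hV).1 j b hb
          exact ⟨Or.inr (Set.mem_iUnion.2 ⟨i, hi⟩), Or.inr ⟨i, hi, this.2⟩⟩
      · rw [h5 j hj (fun i h => hi ⟨i, h⟩)] at hb
        cases hb

theorem trans_post_id (P : PNet.{u, v, w} 𝔸 ι) :
    ∀ t ∈ P.trans, ∀ x ∉ P.vars, t.post x = .var x := by
  cases P with
  | leaf L =>
    intro t ht
    refine saturate_post_id ?_ ht
    rintro _ ⟨h⟩ x hx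
    rename_i s α g asg s'
    cases hx' : asg x with
    | none => simp [hx']
    | some e => exact absurd (L.asg_vars h x e hx').1 hx
  | node I name sub J sort SV =>
    intro t ht
    refine saturate_post_id ?_ ht
    rintro t ⟨V, -, σ, r, -, -, -, -, -, -, -, -, -, h⟩ x hx
    exact h x fun i _ hi => hx (Set.mem_iUnion.2 ⟨i, hi⟩)

theorem trans_closed (P : PNet.{u, v, w} 𝔸 ι) :
    ∀ t ∈ P.trans, ∀ σ : 𝔸.Subst, (∀ x ∈ P.vars, σ x = .var x) → ∀ p : 𝔸.Predicate,
      t.refine P.vars σ p ∈ P.trans := by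
  cases P with
  | leaf L => exact fun t ht σ hσ p => Saturate.refine ht σ hσ p
  | node I name sub J sort SV => exact fun t ht σ hσ p => Saturate.refine ht σ hσ p

/-- The open automaton that is the semantics of a pNet. -/
def automaton (P : PNet.{u, v, w} 𝔸 ι) : OpenAutomaton.{u, v, w} 𝔸 ι where
  holes := P.holes
  sort := P.holeSort
  State := P.State
  init := P.initState
  vars := P.vars
  trans := P.trans
  act_mem := P.trans_act_mem
  post_id := P.trans_post_id
  closed := P.trans_closed

end PNet

/-! ## Weak open transitions and weak bisimulation -/

/-- Weak open transitions: as open transitions, but with a list of actions for each hole (the empty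
list for the holes that are not involved). -/
@[ext]
structure WeakTransition (𝔸 : TermAlgebra.{u}) (ι : Type w) (S : Type v) where
  acts : ι → List (Act 𝔸)
  pred : 𝔸.Predicate
  post : 𝔸.Subst
  src : S
  lab : Act 𝔸
  tgt : S

open Classical in
/-- The observable part of the action of a hole, as a list of length at most one. -/
noncomputable def vis : Option (Act 𝔸) → List (Act 𝔸)
  | none => []
  | some a => if a = Act.tau 𝔸 then [] else [a]

/-- The weak open transitions derived from an open automaton. -/
inductive OpenAutomaton.Weak (A : OpenAutomaton.{u, v, w} 𝔸 ι) :
    WeakTransition 𝔸 ι A.State → Prop where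
  | idle (s : A.State) : A.Weak
      { acts := fun _ => [], pred := fun _ => True, post := .var, src := s, lab := Act.tau 𝔸,
        tgt := s }
  | single (t : OpenTransition 𝔸 ι A.State) (ht : t ∈ A.trans) : A.Weak
      { acts := fun j => vis (t.act j), pred := t.pred, post := t.post, src := t.src,
        lab := t.lab, tgt := t.tgt }
  | comp (w₁ w₂ w₃ : WeakTransition 𝔸 ι A.State)
      (h₁ : A.Weak w₁) (h₂ : A.Weak w₂) (h₃ : A.Weak w₃)
      (l₁ : w₁.lab = Act.tau 𝔸) (l₃ : w₃.lab = Act.tau 𝔸)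
      (h₁₂ : w₁.tgt = w₂.src) (h₂₃ : w₂.tgt = w₃.src) : A.Weak
      { acts := fun j => w₁.acts j ++ (w₂.acts j).map (Act.subst w₁.post) ++
          (w₃.acts j).map (Act.subst (TermAlgebra.Subst.comp w₂.post w₁.post))
        pred := fun ρ => w₁.pred ρ ∧ w₂.pred (TermAlgebra.Subst.apply w₁.post ρ) ∧
          w₃.pred (TermAlgebra.Subst.apply (TermAlgebra.Subst.comp w₂.post w₁.post) ρ)
        post := TermAlgebra.Subst.comp w₃.post (TermAlgebra.Subst.comp w₂.post w₁.post)
        src := w₁.src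
        lab := w₂.lab.subst w₁.post
        tgt := w₃.tgt }

/-- A relation between the states of two open automata: it associates to each pair of states a
predicate over the variables of the first automaton (read in the first valuation) and the
variables of the second automaton (read in the second valuation). -/
abbrev StateRel (A B : OpenAutomaton.{u, v, w} 𝔸 ι) : Type (max u v) :=
  A.State → B.State → 𝔸.Valuation → 𝔸.Valuation → Prop

/-- Each open transition of `A` is covered by a family of weak open transitions of `B`.

When `A` and `B` have disjoint sets of variables, the condition that `ρ₁` and `ρ₂` agree outside
`A.vars ∩ B.vars` says `ρ₁ = ρ₂`: there is a single valuation. When the two automata use some common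
names, these are renamed apart, that is, they have independent values in `A` (`ρ₁`)
and in `B` (`ρ₂`). -/
def WeaklyCovered (A B : OpenAutomaton.{u, v, w} 𝔸 ι) (R : StateRel A B) : Prop :=
  ∀ (s : A.State) (t : B.State) (o : OpenTransition 𝔸 ι A.State), o ∈ A.trans → o.src = s →
    ∃ X : Set (WeakTransition 𝔸 ι B.State),
      (∀ x ∈ X, B.Weak x ∧ x.src = t ∧
        ∀ j, x.acts j ≠ [] ↔ ∃ b, o.act j = some b ∧ b ≠ Act.tau 𝔸) ∧
      ∀ ρ₁ ρ₂ : 𝔸.Valuation, (∀ y, y ∉ A.vars ∩ B.vars → ρ₁ y = ρ₂ y) →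
        R s t ρ₁ ρ₂ → o.pred ρ₁ →
        ∃ x ∈ X,
          (∀ j, (vis (o.act j)).map (Act.eval ρ₁) = (x.acts j).map (Act.eval ρ₂)) ∧
          x.pred ρ₂ ∧
          o.lab.eval ρ₁ = x.lab.eval ρ₂ ∧
          R o.tgt x.tgt (TermAlgebra.Subst.apply o.post ρ₁) (TermAlgebra.Subst.apply x.post ρ₂)

/-- Weak FH-bisimulations. The first condition says that the predicates of `R` only depend on the
variables of the two automata. -/
def IsWeakFHBisimulation (A B : OpenAutomaton.{u, v, w} 𝔸 ι) (R : StateRel A B) : Prop :=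
  (∀ s t (ρ₁ ρ₁' ρ₂ ρ₂' : 𝔸.Valuation), (∀ x ∈ A.vars, ρ₁ x = ρ₁' x) →
    (∀ x ∈ B.vars, ρ₂ x = ρ₂' x) → (R s t ρ₁ ρ₂ ↔ R s t ρ₁' ρ₂')) ∧
  WeaklyCovered A B R ∧
  WeaklyCovered B A fun t s ρ₂ ρ₁ => R s t ρ₁ ρ₂

/-- Two pNets are weak FH-bisimilar if they have the same holes with the same sorts and if some
weak FH-bisimulation between their open automata associates to the initial states a predicate that
is true, whatever the initial values of the variables (a variable name that occurs
in both pNets has the same initial value in both). -/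
def PNet.WeakFHBisimilar (P Q : PNet.{u, v, w} 𝔸 ι) : Prop :=
  P.automaton.holes = Q.automaton.holes ∧
  (∀ j ∈ P.automaton.holes, P.automaton.sort j = Q.automaton.sort j) ∧
  ∃ R : StateRel P.automaton Q.automaton,
    IsWeakFHBisimulation P.automaton Q.automaton R ∧
    ∀ ρ : 𝔸.Valuation, R P.automaton.init Q.automaton.init ρ ρ

/-! ## Evaluation of substituted terms -/

/-! Predicates are sets of valuations and equations compare values, so open transitions matter only
through their ground instances: a valuation satisfying the predicate, evaluated actions, and the
valuation after the effect. The disjunction over a family of weak transitions may be resolved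
separately at each valuation, so covering reduces to the usual clause "each ground step is answered
by a ground weak transition" (`weaklyCovered_iff`).

At this level the proof is the classical congruence argument. Two states of the filled pNets are
related when the context is in the same state with the same values of its variables, and the
fillings are related (`PNet.fillRel`). A ground step of the node is one vector `V`, a valuation `ν`
of its variables, and one step of each sub-pNet involved (`PNet.nodeStep_of_step`, with converse
`PNet.WF.step_of_nodeStep`). Consider what `V` does at `j₀`.

If `V` does not involve `j₀`, the same vector answers. If `V` expects a visible action there, the
answer of `Q'` is a weak transition with exactly one step carrying that action. This step is
combined with the moves of the context by `V`, and the silent steps around it are lifted by the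
vector that lets `j₀` do `τ` alone (`PNet.WF.groundWeak_fill`). If `V` expects `τ`, the answer of
`Q'` may well be idle, so the context must not take part in the step; non-observability says exactly
this, and the whole answer is lifted by the silent vector (`PNet.WF.groundWeak_fill_tau`). -/

theorem Expr.eval_subst (σ : 𝔸.Subst) (ρ : 𝔸.Valuation) (e : 𝔸.Exp) :
    (e.subst σ).eval ρ = e.eval (σ.apply ρ) := by
  induction e with
  | val c => rfl
  | var x => rfl
  | op o args ih => simp only [Expr.subst, Expr.eval, ih]

theorem Act.eval_subst (σ : 𝔸.Subst) (ρ : 𝔸.Valuation) (a : Act 𝔸) :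
    (a.subst σ).eval ρ = a.eval (σ.apply ρ) := by
  simp only [Act.subst, Act.eval, List.map_map, Prod.mk.injEq, true_and]
  exact List.map_congr_left fun e _ => Expr.eval_subst σ ρ e

theorem TermAlgebra.Subst.apply_comp (σ τ : 𝔸.Subst) (ρ : 𝔸.Valuation) :
    (σ.comp τ).apply ρ = σ.apply (τ.apply ρ) :=
  funext fun x => Expr.eval_subst τ ρ (σ x)

/-- Ground actions: a label and a list of values. -/
abbrev TermAlgebra.GroundAct (𝔸 : TermAlgebra.{u}) : Type u := 𝔸.Lab × List 𝔸.Val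

/-- The silent ground action. -/
def TermAlgebra.groundTau (𝔸 : TermAlgebra.{u}) : 𝔸.GroundAct := (𝔸.tauLab, [])

theorem Act.eval_tau (ρ : 𝔸.Valuation) : (Act.tau 𝔸).eval ρ = 𝔸.groundTau := rfl

/-- As `τ` has no arguments, being silent does not depend on the valuation. Hence observability can
be decided equally on terms and on values. -/
theorem Act.eval_eq_groundTau {ρ : 𝔸.Valuation} {a : Act 𝔸} :
    a.eval ρ = 𝔸.groundTau ↔ a = Act.tau 𝔸 := by
  cases a
  simp [Act.eval, TermAlgebra.groundTau, Act.tau]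

open Classical in
/-- The observable part of a ground action of a hole. -/
noncomputable def groundVis : Option 𝔸.GroundAct → List 𝔸.GroundAct
  | none => []
  | some a => if a = 𝔸.groundTau then [] else [a]

theorem map_vis (ρ : 𝔸.Valuation) (o : Option (Act 𝔸)) :
    (vis o).map (Act.eval ρ) = groundVis (o.map (Act.eval ρ)) := by
  cases o with
  | none => rfl
  | some a =>
    by_cases h : a = Act.tau 𝔸 <;>
      simp [vis, groundVis, h, Act.eval_eq_groundTau, Act.eval_tau]

theorem vis_ne_nil {o : Option (Act 𝔸)} : vis o ≠ [] ↔ ∃ b, o = some b ∧ b ≠ Act.tau 𝔸 := by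
  cases o with
  | none => simp [vis]
  | some a => by_cases h : a = Act.tau 𝔸 <;> simp [vis, h]

open Classical in
/-- The valuation that follows `ρ` on `V` and `κ` elsewhere. -/
noncomputable def TermAlgebra.Valuation.mix (V : Set 𝔸.Var) (ρ κ : 𝔸.Valuation) : 𝔸.Valuation :=
  fun x => if x ∈ V then ρ x else κ x

theorem TermAlgebra.Valuation.mix_of_mem {V : Set 𝔸.Var} {ρ κ : 𝔸.Valuation} {x : 𝔸.Var}
    (h : x ∈ V) : TermAlgebra.Valuation.mix V ρ κ x = ρ x := if_pos h

theorem TermAlgebra.Valuation.mix_of_notMem {V : Set 𝔸.Var} {ρ κ : 𝔸.Valuation} {x : 𝔸.Var}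
    (h : x ∉ V) : TermAlgebra.Valuation.mix V ρ κ x = κ x := if_neg h

open TermAlgebra.Valuation (mix mix_of_mem mix_of_notMem)

/-! ## Ground transitions -/

namespace OpenAutomaton

/-- Instances of open transitions: the valuation `ρ` satisfies the predicate, and all actions
are evaluated under it; `ρ'` is the valuation after the effect. -/
def Step (A : OpenAutomaton.{u, v, w} 𝔸 ι) (s : A.State) (ρ : 𝔸.Valuation)
    (f : ι → Option 𝔸.GroundAct) (l : 𝔸.GroundAct) (s' : A.State) (ρ' : 𝔸.Valuation) : Prop :=
  ∃ t ∈ A.trans, t.src = s ∧ t.tgt = s' ∧ t.pred ρ ∧ (∀ j, f j = (t.act j).map (Act.eval ρ)) ∧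
    l = t.lab.eval ρ ∧ ρ' = t.post.apply ρ

/-- Instances of weak open transitions. -/
inductive GroundWeak (A : OpenAutomaton.{u, v, w} 𝔸 ι) : A.State → 𝔸.Valuation →
    (ι → List 𝔸.GroundAct) → 𝔸.GroundAct → A.State → 𝔸.Valuation → Prop where
  | idle (s ρ) : A.GroundWeak s ρ (fun _ => []) 𝔸.groundTau s ρ
  | single {s ρ f l s' ρ'} (h : A.Step s ρ f l s' ρ') :
      A.GroundWeak s ρ (fun j => groundVis (f j)) l s' ρ'
  | comp {s₀ s₁ s₂ s₃ ρ₀ ρ₁ ρ₂ ρ₃ γ₁ γ₂ γ₃ l}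
      (h₁ : A.GroundWeak s₀ ρ₀ γ₁ 𝔸.groundTau s₁ ρ₁) (h₂ : A.GroundWeak s₁ ρ₁ γ₂ l s₂ ρ₂)
      (h₃ : A.GroundWeak s₂ ρ₂ γ₃ 𝔸.groundTau s₃ ρ₃) :
      A.GroundWeak s₀ ρ₀ (fun j => γ₁ j ++ γ₂ j ++ γ₃ j) l s₃ ρ₃

variable {A : OpenAutomaton.{u, v, w} 𝔸 ι}

/-- Applying an effect to a later label or predicate amounts to evaluating it in the valuation
reached after that effect, so composites of weak transitions become plain concatenations of runs. -/
theorem Weak.groundWeak {x : WeakTransition 𝔸 ι A.State} (h : A.Weak x) (ρ : 𝔸.Valuation)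
    (hρ : x.pred ρ) : A.GroundWeak x.src ρ (fun j => (x.acts j).map (Act.eval ρ))
      (x.lab.eval ρ) x.tgt (x.post.apply ρ) := by
  induction h generalizing ρ with
  | idle s => exact .idle s ρ
  | single t ht =>
    simp only [map_vis]
    exact .single ⟨t, ht, rfl, rfl, hρ, fun _ => rfl, rfl, rfl⟩
  | comp w₁ w₂ w₃ h₁ h₂ h₃ l₁ l₃ h₁₂ h₂₃ ih₁ ih₂ ih₃ =>
    obtain ⟨p₁, p₂, p₃⟩ := hρ
    rw [TermAlgebra.Subst.apply_comp] at p₃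
    have g₁ := ih₁ ρ p₁
    have g₂ := ih₂ _ p₂
    have g₃ := ih₃ _ p₃
    rw [l₁, h₁₂] at g₁
    rw [l₃, ← h₂₃] at g₃
    have := GroundWeak.comp g₁ g₂ g₃
    simpa only [List.map_append, List.map_map, Function.comp_def, Act.eval_subst,
      TermAlgebra.Subst.apply_comp] using this

theorem GroundWeak.exists_weak {s s' : A.State} {ρ ρ' : 𝔸.Valuation} {γ : ι → List 𝔸.GroundAct}
    {l : 𝔸.GroundAct} (h : A.GroundWeak s ρ γ l s' ρ') :
    ∃ x, A.Weak x ∧ x.src = s ∧ x.tgt = s' ∧ x.pred ρ ∧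
      (∀ j, γ j = (x.acts j).map (Act.eval ρ)) ∧ l = x.lab.eval ρ ∧ ρ' = x.post.apply ρ := by
  induction h with
  | idle s ρ => exact ⟨_, .idle s, rfl, rfl, trivial, fun _ => rfl, rfl, rfl⟩
  | single h =>
    obtain ⟨t, ht, rfl, rfl, hp, hf, rfl, rfl⟩ := h
    refine ⟨_, .single t ht, rfl, rfl, hp, fun j => ?_, rfl, rfl⟩
    simp only [map_vis, hf]
  | comp h₁ h₂ h₃ ih₁ ih₂ ih₃ =>
    obtain ⟨w₁, k₁, rfl, rfl, p₁, f₁, l₁, rfl⟩ := ih₁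
    obtain ⟨w₂, k₂, e₁₂, rfl, p₂, f₂, rfl, rfl⟩ := ih₂
    obtain ⟨w₃, k₃, e₂₃, rfl, p₃, f₃, l₃, rfl⟩ := ih₃
    refine ⟨_, .comp w₁ w₂ w₃ k₁ k₂ k₃ (Act.eval_eq_groundTau.1 l₁.symm)
      (Act.eval_eq_groundTau.1 l₃.symm) e₁₂.symm e₂₃.symm, rfl, rfl, ⟨p₁, p₂, ?_⟩,
      fun j => ?_, ?_, ?_⟩
    · rwa [TermAlgebra.Subst.apply_comp]
    · simp only [f₁, f₂, f₃, List.map_append, List.map_map, Function.comp_def, Act.eval_subst,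
        TermAlgebra.Subst.apply_comp]
    · rw [Act.eval_subst]
    · simp only [TermAlgebra.Subst.apply_comp]

theorem Step.eq_of_notMem_vars {s s' : A.State} {ρ ρ' : 𝔸.Valuation}
    {f : ι → Option 𝔸.GroundAct} {l : 𝔸.GroundAct} (h : A.Step s ρ f l s' ρ') {x : 𝔸.Var}
    (hx : x ∉ A.vars) : ρ' x = ρ x := by
  obtain ⟨t, ht, -, -, -, -, -, rfl⟩ := h
  simp only [TermAlgebra.Subst.apply, A.post_id t ht x hx, Expr.eval]

theorem Step.eq_none_of_notMem_holes {s s' : A.State} {ρ ρ' : 𝔸.Valuation}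
    {f : ι → Option 𝔸.GroundAct} {l : 𝔸.GroundAct} (h : A.Step s ρ f l s' ρ') {j : ι}
    (hj : j ∉ A.holes) : f j = none := by
  obtain ⟨t, ht, -, -, -, hf, -, -⟩ := h
  rw [hf, Option.map_eq_none_iff, Option.eq_none_iff_forall_ne_some]
  exact fun b hb => hj (A.act_mem t ht j b hb).1

/-- The values of the variables that do not belong to the automaton are irrelevant. -/
theorem Step.congr_valuation {s s' : A.State} {ρ ρ' κ : 𝔸.Valuation}
    {f : ι → Option 𝔸.GroundAct} {l : 𝔸.GroundAct} (h : A.Step s ρ f l s' ρ')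
    (hκ : ∀ x ∈ A.vars, κ x = ρ x) : A.Step s κ f l s' (mix A.vars ρ' κ) := by
  classical
  obtain ⟨t, ht, rfl, rfl, hp, hf, rfl, rfl⟩ := h
  -- Freeze the foreign variables at their values under `ρ`. This is an admissible refinement, and
  -- the refined transition under `κ` is the original one under `ρ`.
  let σ : 𝔸.Subst := fun x => if x ∈ A.vars then .var x else .val (ρ x)
  have hσ : σ.apply κ = ρ := by
    funext x
    by_cases hx : x ∈ A.vars <;> simp [σ, TermAlgebra.Subst.apply, hx, Expr.eval, hκ]
  refine ⟨t.refine A.vars σ fun _ => True, A.closed t ht σ (fun x hx => if_pos hx) _, rfl, rfl,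
    ⟨by rwa [hσ], trivial⟩, fun j => ?_, ?_, ?_⟩
  · simp only [hf, OpenTransition.refine, Option.map_map, Function.comp_def, Act.eval_subst, hσ]
  · simp only [OpenTransition.refine, Act.eval_subst, hσ]
  · funext x
    by_cases hx : x ∈ A.vars
    · simp only [mix_of_mem hx, OpenTransition.refine, TermAlgebra.Subst.apply, if_pos hx,
        Expr.eval_subst]
      rw [show TermAlgebra.Subst.apply σ κ = ρ from hσ]
    · simp only [mix_of_notMem hx, OpenTransition.refine, TermAlgebra.Subst.apply, if_neg hx,
        Expr.eval]

theorem GroundWeak.eq_of_notMem_vars {s s' : A.State} {ρ ρ' : 𝔸.Valuation}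
    {γ : ι → List 𝔸.GroundAct} {l : 𝔸.GroundAct} (h : A.GroundWeak s ρ γ l s' ρ') {x : 𝔸.Var}
    (hx : x ∉ A.vars) : ρ' x = ρ x := by
  induction h with
  | idle => rfl
  | single h => exact h.eq_of_notMem_vars hx
  | comp _ _ _ ih₁ ih₂ ih₃ => rw [ih₃, ih₂, ih₁]

theorem GroundWeak.eq_nil_of_notMem_holes {s s' : A.State} {ρ ρ' : 𝔸.Valuation}
    {γ : ι → List 𝔸.GroundAct} {l : 𝔸.GroundAct} (h : A.GroundWeak s ρ γ l s' ρ') {j : ι}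
    (hj : j ∉ A.holes) : γ j = [] := by
  induction h with
  | idle => rfl
  | single h => simp only [h.eq_none_of_notMem_holes hj, groundVis]
  | comp _ _ _ ih₁ ih₂ ih₃ => simp only [ih₁, ih₂, ih₃, List.append_nil]

theorem GroundWeak.congr_valuation {s s' : A.State} {ρ ρ' κ : 𝔸.Valuation}
    {γ : ι → List 𝔸.GroundAct} {l : 𝔸.GroundAct} (h : A.GroundWeak s ρ γ l s' ρ')
    (hκ : ∀ x ∈ A.vars, κ x = ρ x) : A.GroundWeak s κ γ l s' (mix A.vars ρ' κ) := by
  induction h generalizing κ with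
  | idle s ρ =>
    have : mix A.vars ρ κ = κ := by
      funext x
      by_cases hx : x ∈ A.vars
      · rw [mix_of_mem hx, hκ x hx]
      · rw [mix_of_notMem hx]
    rw [this]
    exact .idle s κ
  | single h => exact .single (h.congr_valuation hκ)
  | @comp _ _ _ _ _ ρ₁ ρ₂ _ _ _ _ _ h₁ h₂ h₃ ih₁ ih₂ ih₃ =>
    -- The intermediate valuations follow the given run on the variables of `A` and `κ` elsewhere;
    -- the nested mixtures collapse at the end.
    have g₂ := ih₂ (κ := mix A.vars ρ₁ κ) fun x hx => mix_of_mem hx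
    have g₃ := ih₃ (κ := mix A.vars ρ₂ (mix A.vars ρ₁ κ)) fun x hx => mix_of_mem hx
    have := GroundWeak.comp (ih₁ hκ) g₂ g₃
    convert this using 1
    funext x
    by_cases hx : x ∈ A.vars
    · simp only [mix_of_mem hx]
    · simp only [mix_of_notMem hx]

end OpenAutomaton

/-- The symbolic clause has no uniformity over valuations beyond the set of holes involved, so the
answer can be chosen instance by instance. -/
theorem weaklyCovered_iff {A B : OpenAutomaton.{u, v, w} 𝔸 ι} {R : StateRel A B} :
    WeaklyCovered A B R ↔ ∀ s t ρ₁ ρ₂ f l s' ρ₁', (∀ y, y ∉ A.vars ∩ B.vars → ρ₁ y = ρ₂ y) →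
      R s t ρ₁ ρ₂ → A.Step s ρ₁ f l s' ρ₁' →
      ∃ t' ρ₂', B.GroundWeak t ρ₂ (fun j => groundVis (f j)) l t' ρ₂' ∧ R s' t' ρ₁' ρ₂' := by
  constructor
  · rintro H s t ρ₁ ρ₂ f l s' ρ₁' hρ hR ⟨o, ho, rfl, rfl, hp, hf, rfl, rfl⟩
    obtain ⟨X, hX, hX'⟩ := H _ t o ho rfl
    obtain ⟨x, hx, hacts, hpx, hl, hR'⟩ := hX' ρ₁ ρ₂ hρ hR hp
    obtain ⟨hw, rfl, -⟩ := hX x hx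
    refine ⟨_, _, ?_, hR'⟩
    have := hw.groundWeak ρ₂ hpx
    rw [← hl] at this
    convert this using 2 with j
    rw [← hacts, map_vis, hf]
  · rintro H s t o ho rfl
    -- The largest admissible family: all weak transitions from `t` with the required set of holes.
    refine ⟨{x | B.Weak x ∧ x.src = t ∧
      ∀ j, x.acts j ≠ [] ↔ ∃ b, o.act j = some b ∧ b ≠ Act.tau 𝔸}, fun x hx => hx, ?_⟩
    intro ρ₁ ρ₂ hρ hR hp
    obtain ⟨t', ρ₂', hw, hR'⟩ := H _ t ρ₁ ρ₂ _ _ _ _ hρ hR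
      ⟨o, ho, rfl, rfl, hp, fun _ => rfl, rfl, rfl⟩
    obtain ⟨x, hx, hs, rfl, hpx, hγ, hl, rfl⟩ := hw.exists_weak
    have hacts : ∀ j, (vis (o.act j)).map (Act.eval ρ₁) = (x.acts j).map (Act.eval ρ₂) :=
      fun j => by rw [map_vis, ← hγ]
    refine ⟨x, ⟨hx, hs, fun j => ?_⟩, hacts, hpx, hl, hR'⟩
    -- Evaluation preserves emptiness of lists, so the condition on the holes follows from the
    -- equality of the evaluated actions.
    rw [← vis_ne_nil, Ne, Ne, ← List.map_eq_nil_iff (f := Act.eval ρ₂), ← hacts,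
      List.map_eq_nil_iff]

/-! ## Ground transitions of a node -/

namespace PNet

variable {I : Type v} {name : I → ι} {sub : I → PNet.{u, v, w} 𝔸 ι} {J : Set ι}
  {sort : ι → Set 𝔸.Sig} {SV : Set (SyncVector 𝔸 ι)}

/-- Instances of the rule for nodes, for the vector `V` whose variables have the values `ν`. -/
structure NodeStep (name : I → ι) (sub : I → PNet.{u, v, w} 𝔸 ι) (J : Set ι)
    (V : SyncVector 𝔸 ι) (ν : 𝔸.Valuation) (s : (i : I) → (sub i).State) (ρ : 𝔸.Valuation)
    (f : ι → Option 𝔸.GroundAct) (l : 𝔸.GroundAct) (s' : (i : I) → (sub i).State)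
    (ρ' : 𝔸.Valuation) : Prop where
  move : ∀ i a, V.act (name i) = some a → ∃ f' ρ'',
    (sub i).automaton.Step (s i) ρ f' (a.eval ν) (s' i) ρ'' ∧
      (∀ j ∈ (sub i).holes, f j = f' j) ∧ ∀ x ∈ (sub i).vars, ρ' x = ρ'' x
  stay : ∀ i, V.act (name i) = none → s' i = s i ∧ (∀ j ∈ (sub i).holes, f j = none) ∧
    ∀ x ∈ (sub i).vars, ρ' x = ρ x
  act_hole : ∀ j ∈ J, f j = (V.act j).map (Act.eval ν)
  act_none : ∀ j ∉ J, (∀ i, j ∉ (sub i).holes) → f j = none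
  lab : l = V.res.eval ν
  guard : V.guard.eval ν = 𝔸.tru
  frame : ∀ x, (∀ i, x ∉ (sub i).vars) → ρ' x = ρ x

theorem NodeStep.congr_valuation {V : SyncVector 𝔸 ι} {ν ρ κ ρ' κ' : 𝔸.Valuation}
    {s s' : (i : I) → (sub i).State} {f : ι → Option 𝔸.GroundAct} {l : 𝔸.GroundAct}
    (h : NodeStep name sub J V ν s ρ f l s' ρ') (hκ : ∀ i, ∀ x ∈ (sub i).vars, κ x = ρ x)
    (hκ' : ∀ i, ∀ x ∈ (sub i).vars, κ' x = ρ' x)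
    (hf : ∀ x, (∀ i, x ∉ (sub i).vars) → κ' x = κ x) :
    NodeStep name sub J V ν s κ f l s' κ' where
  move i a hV := by
    obtain ⟨f', ρ'', hs, hf', hρ⟩ := h.move i a hV
    refine ⟨f', _, hs.congr_valuation (hκ i), hf', fun x hx => ?_⟩
    rw [hκ' i x hx, hρ x hx]
    exact (mix_of_mem hx).symm
  stay i hV := by
    obtain ⟨h₁, h₂, h₃⟩ := h.stay i hV
    exact ⟨h₁, h₂, fun x hx => by rw [hκ' i x hx, h₃ x hx, hκ i x hx]⟩
  act_hole := h.act_hole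
  act_none := h.act_none
  lab := h.lab
  guard := h.guard
  frame := hf

theorem NodeRule.nodeStep
    (hvars : ∀ i i', i ≠ i' → Disjoint (sub i).vars (sub i').vars)
    {T : OpenTransition 𝔸 ι ((i : I) → (sub i).State)}
    (h : NodeRule name sub J sort SV (fun i => (sub i).trans) T) {ρ : 𝔸.Valuation}
    (hρ : T.pred ρ) : ∃ V ∈ SV, ∃ ν, NodeStep name sub J V ν T.src ρ
      (fun j => (T.act j).map (Act.eval ρ)) (T.lab.eval ρ) T.tgt (T.post.apply ρ) := by
  obtain ⟨V, hV, σ, r, hr, hst, hJ₀, hJ, hh, hh₀, hn, hp, hpost, hpost₀⟩ := h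
  rw [hp] at hρ
  obtain ⟨p₁, p₂, p₃, p₄, p₅⟩ := hρ
  refine ⟨V, hV, σ.apply ρ, ?_, ?_, ?_, ?_, ?_, ?_, ?_⟩
  · intro i a ha
    have ha' : V.act (name i) ≠ none := by simp [ha]
    obtain ⟨h₁, h₂, h₃⟩ := hr i ha'
    refine ⟨_, _, ⟨r i, h₁, h₂, h₃, p₁ i ha', fun _ => rfl, ?_, rfl⟩, fun j hj => ?_,
      fun x hx => ?_⟩
    · rw [p₂ i a ha, Act.eval_subst]
    · rw [hh i ha' j hj]
    · simp only [TermAlgebra.Subst.apply, hpost i ha' x hx]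
  · intro i hi
    refine ⟨hst i hi, fun j hj => ?_, fun x hx => ?_⟩
    · rw [hh₀ i hi j hj, Option.map_none]
    · have hx' : ∀ i', V.act (name i') ≠ none → x ∉ (sub i').vars := fun i' hi' =>
        Set.disjoint_left.1 (hvars i i' (by rintro rfl; exact hi' hi)) hx
      simp only [TermAlgebra.Subst.apply, hpost₀ x hx', Expr.eval]
  · intro j hj
    cases hVj : V.act j with
    | none => rw [hJ₀ j hj hVj, Option.map_none, Option.map_none]
    | some a =>
      obtain ⟨b, hb, -⟩ := hJ j hj (by simp [hVj])
      rw [hb, Option.map_some, Option.map_some, p₃ j hj a b hVj hb, Act.eval_subst]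
  · intro j hj hj'
    rw [hn j hj hj', Option.map_none]
  · rw [p₄, Act.eval_subst]
  · rw [← p₅, Expr.eval_subst]
  · intro x hx
    simp only [TermAlgebra.Subst.apply, hpost₀ x fun i _ => hx i, Expr.eval]

/-- Refinement creates no new ground steps: an instance of a refined transition under `ρ` is an
instance of the original one under `σ.apply ρ`, which agrees with `ρ` on the variables of the node.
-/
theorem nodeStep_of_step (hvars : ∀ i i', i ≠ i' → Disjoint (sub i).vars (sub i').vars)
    {s s' : (i : I) → (sub i).State} {ρ ρ' : 𝔸.Valuation} {f : ι → Option 𝔸.GroundAct}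
    {l : 𝔸.GroundAct} (h : (node I name sub J sort SV).automaton.Step s ρ f l s' ρ') :
    ∃ V ∈ SV, ∃ ν, NodeStep name sub J V ν s ρ f l s' ρ' := by
  obtain ⟨t, ht, rfl, rfl, hp, hf, rfl, rfl⟩ := h
  obtain rfl : f = _ := funext hf
  clear hf
  change Saturate _ _ t at ht
  induction ht generalizing ρ with
  | base h => exact NodeRule.nodeStep hvars h hp
  | @refine t h σ hσ p ih =>
    obtain ⟨V, hV, ν, hN⟩ := ih hp.1
    have hi : ∀ i, ∀ x ∈ (sub i).vars, x ∈ (node I name sub J sort SV).vars :=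
      fun i x hx => Set.mem_iUnion.2 ⟨i, hx⟩
    refine ⟨V, hV, ν, ?_⟩
    simp only [OpenTransition.refine, Option.map_map, Function.comp_def, Act.eval_subst]
    refine hN.congr_valuation (fun i x hx => ?_) (fun i x hx => ?_) (fun x hx => ?_)
    · simp only [TermAlgebra.Subst.apply, hσ x (hi i x hx), Expr.eval]
    · simp only [TermAlgebra.Subst.apply, if_pos (hi i x hx), Expr.eval_subst]
    · have : x ∉ (node I name sub J sort SV).vars := fun h =>
        (Set.mem_iUnion.1 h).elim hx
      simp only [TermAlgebra.Subst.apply, if_neg this, Expr.eval]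

/-- An unrefined instance of the node rule suffices if the vector is instantiated by the constants
`ν x`. Disjointness of the variables and holes of the sub-pNets makes the glued effects and hole
actions well defined, and well-formedness of the vector puts the hole actions in their sorts. -/
theorem WF.step_of_nodeStep (hwf : (node I name sub J sort SV).WF) {V : SyncVector 𝔸 ι}
    (hV : V ∈ SV) {ν ρ ρ' : 𝔸.Valuation} {s s' : (i : I) → (sub i).State}
    {f : ι → Option 𝔸.GroundAct} {l : 𝔸.GroundAct}
    (h : NodeStep name sub J V ν s ρ f l s' ρ') :
    (node I name sub J sort SV).automaton.Step s ρ f l s' ρ' := by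
  classical
  obtain ⟨-, -, hname, -, hvars, hholes, hholesJ, hSV⟩ := hwf
  have hr : ∀ i, ∃ r : OpenTransition 𝔸 ι (sub i).State, ∀ a, V.act (name i) = some a →
      r ∈ (sub i).trans ∧ r.src = s i ∧ r.tgt = s' i ∧ r.pred ρ ∧
        (∀ j ∈ (sub i).holes, f j = (r.act j).map (Act.eval ρ)) ∧
        a.eval ν = r.lab.eval ρ ∧ ∀ x ∈ (sub i).vars, ρ' x = (r.post x).eval ρ := by
    intro i
    cases ha : V.act (name i) with
    | none =>
      exact ⟨⟨fun _ => none, fun _ => True, Expr.var, s i, Act.tau 𝔸, s i⟩, by simp⟩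
    | some a =>
      obtain ⟨f', ρ'', ⟨r, hr, h₁, h₂, h₃, h₄, h₅, rfl⟩, hf', hρ⟩ := h.move i a ha
      refine ⟨r, fun a' ha' => ?_⟩
      cases ha'
      exact ⟨hr, h₁, h₂, h₃, fun j hj => by rw [hf' j hj, h₄], h₅, hρ⟩
  choose r hr using hr
  have hr' : ∀ i, V.act (name i) ≠ none → r i ∈ (sub i).trans ∧ (r i).src = s i ∧
      (r i).tgt = s' i ∧ (r i).pred ρ ∧
      (∀ j ∈ (sub i).holes, f j = ((r i).act j).map (Act.eval ρ)) ∧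
      ∀ x ∈ (sub i).vars, ρ' x = ((r i).post x).eval ρ := by
    intro i hi
    obtain ⟨a, ha⟩ := Option.ne_none_iff_exists'.1 hi
    obtain ⟨h₁, h₂, h₃, h₄, h₅, -, h₆⟩ := hr i a ha
    exact ⟨h₁, h₂, h₃, h₄, h₅, h₆⟩
  let σ : 𝔸.Subst := fun x => .val (ν x)
  have hσ : σ.apply ρ = ν := rfl
  let act : ι → Option (Act 𝔸) := fun j =>
    if j ∈ J then (V.act j).map (Act.subst σ) else
      if h : ∃ i, V.act (name i) ≠ none ∧ j ∈ (sub i).holes then (r h.choose).act j else none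
  let post : 𝔸.Subst := fun x =>
    if h : ∃ i, V.act (name i) ≠ none ∧ x ∈ (sub i).vars then (r h.choose).post x else .var x
  have act_J : ∀ j ∈ J, act j = (V.act j).map (Act.subst σ) := fun j hj => if_pos hj
  have act_sub : ∀ i, V.act (name i) ≠ none → ∀ j ∈ (sub i).holes, act j = (r i).act j := by
    intro i hi j hj
    have hex : ∃ i, V.act (name i) ≠ none ∧ j ∈ (sub i).holes := ⟨i, hi, hj⟩
    have : hex.choose = i := by
      by_contra hne
      exact Set.disjoint_left.1 (hholes _ _ hne) hex.choose_spec.2 hj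
    simp only [act, if_neg (Set.disjoint_left.1 (hholesJ i) hj), dif_pos hex]
    rw [this]
  have act_else : ∀ j, j ∉ J → (∀ i, V.act (name i) ≠ none → j ∉ (sub i).holes) →
      act j = none := by
    intro j hj hj'
    simp only [act, if_neg hj]
    exact dif_neg fun ⟨i, hi, hij⟩ => hj' i hi hij
  have post_sub : ∀ i, V.act (name i) ≠ none → ∀ x ∈ (sub i).vars,
      post x = (r i).post x := by
    intro i hi x hx
    have hex : ∃ i, V.act (name i) ≠ none ∧ x ∈ (sub i).vars := ⟨i, hi, hx⟩
    have : hex.choose = i := by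
      by_contra hne
      exact Set.disjoint_left.1 (hvars _ _ hne) hex.choose_spec.2 hx
    simp only [post, dif_pos hex]
    rw [this]
  have post_else : ∀ x, (∀ i, V.act (name i) ≠ none → x ∉ (sub i).vars) → post x = .var x :=
    fun x hx => dif_neg fun ⟨i, hi, hix⟩ => hx i hi hix
  have stay_holes : ∀ i, V.act (name i) = none → ∀ j ∈ (sub i).holes,
      ∀ i', V.act (name i') ≠ none → j ∉ (sub i').holes := fun i hi j hj i' hi' =>
    Set.disjoint_left.1 (hholes i i' (by rintro rfl; exact hi' hi)) hj
  have stay_vars : ∀ i, V.act (name i) = none → ∀ x ∈ (sub i).vars,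
      ∀ i', V.act (name i') ≠ none → x ∉ (sub i').vars := fun i hi x hx i' hi' =>
    Set.disjoint_left.1 (hvars i i' (by rintro rfl; exact hi' hi)) hx
  let T : OpenTransition 𝔸 ι ((i : I) → (sub i).State) :=
    { act := act
      pred := fun ρ =>
        (∀ i, V.act (name i) ≠ none → (r i).pred ρ) ∧
        (∀ i a, V.act (name i) = some a → (r i).lab.eval ρ = (a.subst σ).eval ρ) ∧
        (∀ j ∈ J, ∀ a b, V.act j = some a → act j = some b →
          b.eval ρ = (a.subst σ).eval ρ) ∧
        (V.res.subst σ).eval ρ = (V.res.subst σ).eval ρ ∧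
        (V.guard.subst σ).eval ρ = 𝔸.tru
      post := post
      src := s
      lab := V.res.subst σ
      tgt := s' }
  have hT : NodeRule name sub J sort SV (fun i => (sub i).trans) T := by
    refine ⟨V, hV, σ, r, fun i hi => ?_, fun i hi => (h.stay i hi).1, fun j hj hVj => ?_,
      fun j hj hVj => ?_, act_sub, fun i hi j hj => ?_, fun j hj hj' => ?_, rfl, post_sub,
      post_else⟩
    · obtain ⟨h₁, h₂, h₃, -⟩ := hr' i hi
      exact ⟨h₁, h₂, h₃⟩
    · exact (act_J j hj).trans (by rw [hVj, Option.map_none])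
    · obtain ⟨a, ha⟩ := Option.ne_none_iff_exists'.1 hVj
      refine ⟨a.subst σ, (act_J j hj).trans (by rw [ha, Option.map_some]), ?_⟩
      rw [Act.sig_subst]
      rcases (hSV V hV).1 j a ha with ⟨i, hi, -⟩ | ⟨-, hs⟩
      -- An index cannot name both a sub-pNet and a hole.
      · exact absurd hj (Set.disjoint_left.1 hname ⟨i, hi⟩)
      · exact hs
    · exact act_else j (Set.disjoint_left.1 (hholesJ i) hj) (stay_holes i hi j hj)
    · exact act_else j hj fun i _ => hj' i
  refine ⟨T, Saturate.base hT, rfl, rfl, ⟨fun i hi => (hr' i hi).2.2.2.1, fun i a ha => ?_,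
    fun j hj a b ha hb => ?_, rfl, ?_⟩, fun j => ?_, ?_, ?_⟩
  · rw [Act.eval_subst, hσ]
    exact (hr i a ha).2.2.2.2.2.1.symm
  · rw [act_J j hj, ha, Option.map_some, Option.some_inj] at hb
    rw [hb]
  · rw [Expr.eval_subst, hσ, h.guard]
  · change f j = (act j).map (Act.eval ρ)
    by_cases hj : j ∈ J
    · simp only [act_J j hj, h.act_hole j hj, Option.map_map, Function.comp_def,
        Act.eval_subst, hσ]
    · by_cases hj' : ∃ i, j ∈ (sub i).holes
      · obtain ⟨i, hi⟩ := hj'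
        by_cases hVi : V.act (name i) = none
        · rw [act_else j hj (stay_holes i hVi j hi), (h.stay i hVi).2.1 j hi, Option.map_none]
        · rw [act_sub i hVi j hi, (hr' i hVi).2.2.2.2.1 j hi]
      · rw [act_else j hj fun i _ hi => hj' ⟨i, hi⟩,
          h.act_none j hj fun i hi => hj' ⟨i, hi⟩, Option.map_none]
  · change l = (V.res.subst σ).eval ρ
    rw [h.lab, Act.eval_subst, hσ]
  · change ρ' = post.apply ρ
    funext x
    by_cases hx : ∃ i, x ∈ (sub i).vars
    · obtain ⟨i, hi⟩ := hx
      by_cases hVi : V.act (name i) = none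
      · simp only [TermAlgebra.Subst.apply, post_else x (stay_vars i hVi x hi),
          (h.stay i hVi).2.2 x hi, Expr.eval]
      · simp only [TermAlgebra.Subst.apply, post_sub i hVi x hi, (hr' i hVi).2.2.2.2.2 x hi]
    · simp only [TermAlgebra.Subst.apply, post_else x fun i _ hi => hx ⟨i, hi⟩, Expr.eval,
        h.frame x fun i hi => hx ⟨i, hi⟩]

end PNet

/-! ## Filling a hole -/

namespace PNet

variable {I : Type v} {name : I → ι} {sub : I → PNet.{u, v, w} 𝔸 ι} {J : Set ι}
  {sort : ι → Set 𝔸.Sig} {SV : Set (SyncVector 𝔸 ι)} {j₀ : ι} {Q Q' : PNet.{u, v, w} 𝔸 ι}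

/-- The states of a node whose hole has been filled. -/
def fillState (q : Q.State) (s : (i : I) → (sub i).State) : (o : Option I) → (o.elim Q sub).State
  | none => q
  | some i => s i

theorem fillState_eta (s : (o : Option I) → (o.elim Q sub).State) :
    s = fillState (s none) fun i => s (some i) := by
  funext o
  cases o <;> rfl

/-- The vector involves only `j₀` and contains no variables, so any valuation serves for it, here
`ρ`. A step of `Q` leaves foreign variables and holes alone, which accounts for the rest of the
node. -/
theorem NodeStep.fill_tau {V : SyncVector 𝔸 ι}
    (hname : ∀ i, name i ≠ j₀) (hj₀ : V.act j₀ = some (Act.tau 𝔸))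
    (hV : ∀ l, l ≠ j₀ → V.act l = none) (hres : V.res = Act.tau 𝔸)
    (hguard : V.guard = Expr.val 𝔸.tru)
    (hvars : ∀ i, Disjoint (sub i).vars Q.vars) (hholes : ∀ i, Disjoint (sub i).holes Q.holes)
    (hJ : Disjoint Q.holes (J \ {j₀})) {q q' : Q.State} {ρ ρ' : 𝔸.Valuation}
    {f : ι → Option 𝔸.GroundAct} (h : Q.automaton.Step q ρ f 𝔸.groundTau q' ρ')
    (s : (i : I) → (sub i).State) :
    NodeStep (fun o : Option I => o.elim j₀ name) (fun o => o.elim Q sub) (J \ {j₀}) V ρ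
      (fillState q s) ρ f 𝔸.groundTau (fillState q' s) ρ' where
  move o a ha := by
    cases o with
    | none =>
      obtain rfl : Act.tau 𝔸 = a := Option.some_inj.1 (hj₀.symm.trans ha)
      exact ⟨f, ρ', h, fun _ _ => rfl, fun _ _ => rfl⟩
    | some i => exact absurd ((hV _ (hname i)).symm.trans ha) (by simp)
  stay o ho := by
    cases o with
    | none => exact absurd (hj₀.symm.trans ho) (by simp)
    | some i =>
      exact ⟨rfl, fun j hj => h.eq_none_of_notMem_holes (Set.disjoint_left.1 (hholes i) hj),
        fun x hx => h.eq_of_notMem_vars (Set.disjoint_left.1 (hvars i) hx)⟩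
  act_hole j hj := by
    rw [hV j hj.2, Option.map_none]
    exact h.eq_none_of_notMem_holes (Set.disjoint_right.1 hJ hj)
  act_none j _ hj := h.eq_none_of_notMem_holes (hj none)
  lab := by rw [hres, Act.eval_tau]
  guard := by rw [hguard, Expr.eval]
  frame x hx := h.eq_of_notMem_vars (hx none)

open Classical in
-- Transplants the context's part of a step onto another filling, with the same `V` and `ν`. The new
-- filling only has to produce the ground action that `V` expects at `j₀`, or stay if none is
-- expected. The result takes the context variables from the old step and all others from the
-- filling.
theorem NodeStep.fill_congr {V : SyncVector 𝔸 ι} {ν ρ ρ' : 𝔸.Valuation}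
    {s s' : (i : I) → (sub i).State} {q₁ q₁' : Q.State}
    {f : ι → Option 𝔸.GroundAct} {l : 𝔸.GroundAct}
    (h : NodeStep (fun o : Option I => o.elim j₀ name) (fun o => o.elim Q sub) (J \ {j₀}) V ν
      (fillState q₁ s) ρ f l (fillState q₁' s') ρ')
    (hvars : ∀ i, Disjoint (sub i).vars Q'.vars) (hholes : ∀ i, Disjoint (sub i).holes Q'.holes)
    (hJ : Disjoint Q'.holes (J \ {j₀})) (hQ : Q.holes = Q'.holes)
    {q q' : Q'.State} {κ κ' : 𝔸.Valuation} {g : ι → Option 𝔸.GroundAct}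
    (hmove : ∀ a, V.act j₀ = some a → Q'.automaton.Step q κ g (a.eval ν) q' κ')
    (hstay : V.act j₀ = none → q' = q ∧ (∀ j ∈ Q'.holes, g j = none) ∧ κ' = κ)
    (hκ : ∀ i, ∀ x ∈ (sub i).vars, κ x = ρ x) :
    NodeStep (fun o : Option I => o.elim j₀ name) (fun o => o.elim Q' sub) (J \ {j₀}) V ν
      (fillState q s) κ (fun j => if j ∈ Q'.holes then g j else f j) l (fillState q' s')
      (mix (⋃ i, (sub i).vars) ρ' κ') where
  move o a ha := by
    cases o with
    | none =>
      refine ⟨g, κ', hmove a ha, fun j hj => if_pos hj, fun x hx => mix_of_notMem ?_⟩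
      intro hx'
      obtain ⟨i, hi⟩ := Set.mem_iUnion.1 hx'
      exact Set.disjoint_left.1 (hvars i) hi hx
    | some i =>
      obtain ⟨f', ρ'', hs, hf, hρ⟩ := h.move (some i) a ha
      refine ⟨f', _, hs.congr_valuation (hκ i), fun j hj => ?_, fun x hx => ?_⟩
      · exact (if_neg (Set.disjoint_left.1 (hholes i) hj)).trans (hf j hj)
      · rw [mix_of_mem (Set.mem_iUnion.2 ⟨i, hx⟩)]
        exact (hρ x hx).trans (mix_of_mem hx).symm
  stay o ho := by
    cases o with
    | none =>
      obtain ⟨h₁, h₂, h₃⟩ := hstay ho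
      refine ⟨h₁, fun j hj => (if_pos hj).trans (h₂ j hj), fun x hx => ?_⟩
      rw [← h₃]
      refine mix_of_notMem fun hx' => ?_
      obtain ⟨i, hi⟩ := Set.mem_iUnion.1 hx'
      exact Set.disjoint_left.1 (hvars i) hi hx
    | some i =>
      obtain ⟨h₁, h₂, h₃⟩ := h.stay (some i) ho
      refine ⟨h₁, fun j hj => ?_, fun x hx => ?_⟩
      · exact (if_neg (Set.disjoint_left.1 (hholes i) hj)).trans (h₂ j hj)
      · rw [mix_of_mem (Set.mem_iUnion.2 ⟨i, hx⟩), hκ i x hx]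
        exact h₃ x hx
  act_hole j hj := by
    rw [← h.act_hole j hj]
    exact if_neg (Set.disjoint_right.1 hJ hj)
  act_none j hj hj' := by
    rw [← h.act_none j hj]
    · exact if_neg (hj' none)
    · rintro (_ | i)
      · change j ∉ Q.holes
        rw [hQ]
        exact hj' none
      · exact hj' (some i)
  lab := h.lab
  guard := h.guard
  frame x hx := by
    refine (mix_of_notMem fun hx' => (Set.mem_iUnion.1 hx').elim fun i => hx (some i)).trans ?_
    cases ha : V.act j₀ with
    | none => rw [(hstay ha).2.2]
    | some a => exact (hmove a ha).eq_of_notMem_vars (hx none)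

/-- Every single step inside a weak transition labelled `τ` is itself labelled `τ`, so the silent
vector lifts them one by one while the context rests. -/
theorem WF.groundWeak_fill_tau (hwf : ((node I name sub J sort SV).fill j₀ Q).WF)
    {V : SyncVector 𝔸 ι} (hVSV : V ∈ SV) (hj₀ : V.act j₀ = some (Act.tau 𝔸))
    (hV : ∀ l, l ≠ j₀ → V.act l = none) (hres : V.res = Act.tau 𝔸)
    (hguard : V.guard = Expr.val 𝔸.tru) {q q' : Q.automaton.State} {ρ ρ' : 𝔸.Valuation}
    {γ : ι → List 𝔸.GroundAct} {l : 𝔸.GroundAct}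
    (h : Q.automaton.GroundWeak q ρ γ l q' ρ') (hl : l = 𝔸.groundTau)
    (s : (i : I) → (sub i).State) :
    ((node I name sub J sort SV).fill j₀ Q).automaton.GroundWeak (fillState q s) ρ γ l
      (fillState q' s) ρ' := by
  induction h with
  | idle q ρ => exact .idle _ ρ
  | single h =>
    subst hl
    have hwf' := hwf
    obtain ⟨-, hname, -, -, hvars, hholes, hJ, -⟩ := hwf
    refine .single (hwf'.step_of_nodeStep hVSV (NodeStep.fill_tau (fun i hi => ?_) hj₀ hV hres
      hguard (fun i => hvars (some i) none (by simp)) (fun i => hholes (some i) none (by simp))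
      (hJ none) h s))
    have : (some i : Option I) = none := hname hi
    simp at this
  | comp _ _ _ ih₁ ih₂ ih₃ => exact .comp (ih₁ rfl) (ih₂ hl) (ih₃ rfl)

open Classical in
-- Along the middle components of nested composites lies one single step carrying the visible label.
-- The context moves from `s` to `s'` at that step through `V`; the flanking runs are silent and
-- leave the context alone. The valuation `κ` varies in the induction because the silent prefix
-- changes the variables of `Q'`.
theorem WF.groundWeak_fill (hwf : ((node I name sub J sort SV).fill j₀ Q').WF)
    {V₀ : SyncVector 𝔸 ι} (hVSV₀ : V₀ ∈ SV) (hj₀ : V₀.act j₀ = some (Act.tau 𝔸))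
    (hV₀ : ∀ l, l ≠ j₀ → V₀.act l = none) (hres : V₀.res = Act.tau 𝔸)
    (hguard : V₀.guard = Expr.val 𝔸.tru) (hQ : Q.holes = Q'.holes)
    {V : SyncVector 𝔸 ι} (hVSV : V ∈ SV) {ν ρ ρ' : 𝔸.Valuation}
    {s s' : (i : I) → (sub i).State} {q₁ q₁' : Q.State}
    {f : ι → Option 𝔸.GroundAct} {l : 𝔸.GroundAct}
    (h : NodeStep (fun o : Option I => o.elim j₀ name) (fun o => o.elim Q sub) (J \ {j₀}) V ν
      (fillState q₁ s) ρ f l (fillState q₁' s') ρ')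
    {a : Act 𝔸} (ha : V.act j₀ = some a) (hne : a ≠ Act.tau 𝔸)
    {q q' : Q'.automaton.State} {κ₀ κ₀' : 𝔸.Valuation} {γ : ι → List 𝔸.GroundAct} {m : 𝔸.GroundAct}
    (hw : Q'.automaton.GroundWeak q κ₀ γ m q' κ₀') (hm : m = a.eval ν)
    {κ : 𝔸.Valuation} (hκ₀ : ∀ x ∈ Q'.vars, κ x = κ₀ x)
    (hκ : ∀ i, ∀ x ∈ (sub i).vars, κ x = ρ x) :
    ∃ κ', ((node I name sub J sort SV).fill j₀ Q').automaton.GroundWeak (fillState q s) κ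
        (fun j => if j ∈ Q'.holes then γ j else groundVis (f j)) l (fillState q' s') κ' ∧
      (∀ x ∈ Q'.vars, κ' x = κ₀' x) ∧ ∀ i, ∀ x ∈ (sub i).vars, κ' x = ρ' x := by
  have hwf' := hwf
  obtain ⟨-, -, -, -, hvars, hholes, hJ, -⟩ := hwf'
  have hvars : ∀ i, Disjoint (sub i).vars Q'.vars := fun i => hvars (some i) none (by simp)
  induction hw generalizing κ with
  -- Idling is labelled `τ`, whereas the action expected by `V` is visible.
  | idle q ρ => exact absurd (Act.eval_eq_groundTau.1 hm.symm) hne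
  | @single q κ₀ g m q' κ₀' hw =>
    subst hm
    have hw := hw.congr_valuation hκ₀
    have := hwf.step_of_nodeStep hVSV (h.fill_congr hvars
      (fun i => hholes (some i) none (by simp)) (hJ none) hQ (q := q) (q' := q') (κ := κ)
      (g := g) (fun b hb => by cases ha.symm.trans hb; exact hw)
      (fun hn => absurd (ha.symm.trans hn) (by simp)) hκ)
    refine ⟨mix (⋃ i, (sub i).vars) ρ' (mix Q'.vars κ₀' κ), ?_, ?_, ?_⟩
    · have := OpenAutomaton.GroundWeak.single this
      simp only [apply_ite groundVis] at this
      exact this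
    · intro x hx
      exact (mix_of_notMem fun hx' => (Set.mem_iUnion.1 hx').elim fun i hi =>
        Set.disjoint_left.1 (hvars i) hi hx).trans (mix_of_mem hx)
    · exact fun i x hx => mix_of_mem (Set.mem_iUnion.2 ⟨i, hx⟩)
  | @comp q₀ q₁ q₂ q₃ ρ₀ ρ₁ ρ₂ ρ₃ γ₁ γ₂ γ₃ m h₁ h₂ h₃ ih₁ ih₂ ih₃ =>
    have g₁ := hwf.groundWeak_fill_tau hVSV₀ hj₀ hV₀ hres hguard (h₁.congr_valuation hκ₀) rfl s
    obtain ⟨κ₂, g₂, e₂, e₂'⟩ := ih₂ hm (κ := mix Q'.vars ρ₁ κ) (fun x hx => mix_of_mem hx)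
      (fun i x hx => by
        rw [mix_of_notMem (Set.disjoint_left.1 (hvars i) hx), hκ i x hx])
    have g₃ := hwf.groundWeak_fill_tau hVSV₀ hj₀ hV₀ hres hguard (h₃.congr_valuation e₂) rfl s'
    refine ⟨mix Q'.vars ρ₃ κ₂, ?_, fun x hx => mix_of_mem hx, fun i x hx =>
      (mix_of_notMem (Set.disjoint_left.1 (hvars i) hx)).trans (e₂' i x hx)⟩
    have := OpenAutomaton.GroundWeak.comp g₁ g₂ g₃
    -- The flanking silent runs contribute actions only at holes of `Q'`.
    have hγ : (fun j => γ₁ j ++ (if j ∈ Q'.holes then γ₂ j else groundVis (f j)) ++ γ₃ j) =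
        fun j => if j ∈ Q'.holes then γ₁ j ++ γ₂ j ++ γ₃ j else groundVis (f j) :=
      funext fun j => by
        split_ifs with hj
        · rfl
        · rw [h₁.eq_nil_of_notMem_holes hj, h₃.eq_nil_of_notMem_holes hj, List.nil_append,
            List.append_nil]
    rw [hγ] at this
    exact this

/-- The relation between `P[Q]` and `P[Q']` that is induced by a relation between `Q` and `Q'`. -/
def fillRel (R : StateRel Q.automaton Q'.automaton) :
    StateRel ((node I name sub J sort SV).fill j₀ Q).automaton
      ((node I name sub J sort SV).fill j₀ Q').automaton :=
  fun (s : (o : Option I) → (o.elim Q sub).State) (t : (o : Option I) → (o.elim Q' sub).State)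
    ρ₁ ρ₂ => (∀ i, (s (some i) : (sub i).State) = t (some i)) ∧
      (∀ i, ∀ x ∈ (sub i).vars, ρ₁ x = ρ₂ x) ∧ R (s none) (t none) ρ₁ ρ₂

theorem vars_fill (Q : PNet.{u, v, w} 𝔸 ι) :
    ((node I name sub J sort SV).fill j₀ Q).vars = Q.vars ∪ ⋃ i, (sub i).vars := by
  simp only [fill, vars, Set.iUnion_option]
  rfl

theorem holes_fill (Q : PNet.{u, v, w} 𝔸 ι) :
    ((node I name sub J sort SV).fill j₀ Q).holes =
      J \ {j₀} ∪ (Q.holes ∪ ⋃ i, (sub i).holes) := by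
  simp only [fill, holes, Set.iUnion_option]
  rfl

theorem holeSort_fill (Q : PNet.{u, v, w} 𝔸 ι) (j : ι) :
    ((node I name sub J sort SV).fill j₀ Q).holeSort j =
      {sg | (j ∈ J \ {j₀} ∧ sg ∈ sort j) ∨ (j ∈ Q.holes ∧ sg ∈ Q.holeSort j) ∨
        ∃ i, j ∈ (sub i).holes ∧ sg ∈ (sub i).holeSort j} := by
  simp only [fill, holeSort, Option.exists]
  rfl

theorem weaklyCovered_fill (hwf : ((node I name sub J sort SV).fill j₀ Q).WF)
    (hwf' : ((node I name sub J sort SV).fill j₀ Q').WF)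
    (hobs : (node I name sub J sort SV).CannotObserveSilent) (hj₀ : j₀ ∈ J)
    (hQ : Q.holes = Q'.holes) {R : StateRel Q.automaton Q'.automaton}
    (hR : ∀ s t (ρ₁ ρ₁' ρ₂ ρ₂' : 𝔸.Valuation), (∀ x ∈ Q.vars, ρ₁ x = ρ₁' x) →
      (∀ x ∈ Q'.vars, ρ₂ x = ρ₂' x) → (R s t ρ₁ ρ₂ ↔ R s t ρ₁' ρ₂'))
    (hcov : WeaklyCovered Q.automaton Q'.automaton R) :
    WeaklyCovered ((node I name sub J sort SV).fill j₀ Q).automaton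
      ((node I name sub J sort SV).fill j₀ Q').automaton (fillRel R) := by
  classical
  obtain ⟨hobs₁, hobs₂⟩ := hobs
  obtain ⟨V₀, hVSV₀, hV₀j₀, hV₀, hres₀, hguard₀⟩ := hobs₁ j₀ (Or.inr hj₀)
  rw [weaklyCovered_iff] at hcov ⊢
  have hwf₂ := hwf'
  obtain ⟨-, -, -, -, hvars₂, hholes₂, hJ₂, -⟩ := hwf₂
  have hvars₂ : ∀ i, Disjoint (sub i).vars Q'.vars := fun i => hvars₂ (some i) none (by simp)
  intro (s : (o : Option I) → (o.elim Q sub).State) (t : (o : Option I) → (o.elim Q' sub).State)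
    ρ₁ ρ₂ f l (s' : (o : Option I) → (o.elim Q sub).State) ρ₁' hρ hrel hstep
  obtain ⟨hst, hρsub, hst₀⟩ := hrel
  -- Context variables agree by the relation. For any other variable, being common to both filled
  -- pNets means being common to `Q` and `Q'`.
  have hρQ : ∀ y, y ∉ Q.vars ∩ Q'.vars → ρ₁ y = ρ₂ y := by
    intro y hy
    by_cases hy' : ∃ i, y ∈ (sub i).vars
    · exact hy'.elim fun i hi => hρsub i y hi
    · refine hρ y ?_
      change y ∉ ((node I name sub J sort SV).fill j₀ Q).vars ∩
        ((node I name sub J sort SV).fill j₀ Q').vars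
      rw [vars_fill, vars_fill, ← Set.inter_union_distrib_right]
      exact fun h => h.elim hy fun h => hy' (Set.mem_iUnion.1 h)
  obtain ⟨V, hVSV, ν, hN⟩ := nodeStep_of_step hwf.2.2.2.2.1 hstep
  obtain ⟨q, s, rfl⟩ : ∃ q s₁, s = fillState q s₁ := ⟨_, _, fillState_eta s⟩
  obtain ⟨q', s', rfl⟩ : ∃ q s₁, s' = fillState q s₁ := ⟨_, _, fillState_eta s'⟩
  obtain ⟨p, t, rfl⟩ : ∃ q s₁, t = fillState q s₁ := ⟨_, _, fillState_eta t⟩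
  obtain rfl : s = t := funext hst
  cases ha : V.act j₀ with
  | none =>
    obtain ⟨h₁, h₂, h₃⟩ := hN.stay none ha
    change q' = q at h₁
    subst h₁
    have hstep' := hwf'.step_of_nodeStep hVSV (hN.fill_congr hvars₂
      (fun i => hholes₂ (some i) none (by simp)) (hJ₂ none) hQ (q := p) (q' := p) (κ := ρ₂)
      (κ' := ρ₂) (g := fun _ => none)
      (fun b hb => absurd (ha.symm.trans hb) (by simp)) (fun _ => ⟨rfl, fun _ _ => rfl, rfl⟩)
      fun i x hx => (hρsub i x hx).symm)
    refine ⟨fillState p s', mix (⋃ i, (sub i).vars) ρ₁' ρ₂, ?_, fun _ => rfl, fun i x hx =>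
      (mix_of_mem (Set.mem_iUnion.2 ⟨i, hx⟩)).symm, ?_⟩
    · have hf : (fun j => if j ∈ Q'.holes then none else f j) = f := funext fun j => by
        split_ifs with hj
        · exact (h₂ j (by rw [← hQ] at hj; exact hj)).symm
        · rfl
      rw [hf] at hstep'
      exact .single hstep'
    -- The context's effect touches no variable of the fillings, and `R` depends on nothing else.
    · refine (hR _ _ _ _ _ _ (fun x hx => (h₃ x hx).symm) fun x hx => ?_).1 hst₀
      refine (mix_of_notMem fun hx' => ?_).symm
      obtain ⟨i, hi⟩ := Set.mem_iUnion.1 hx'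
      exact Set.disjoint_left.1 (hvars₂ i) hi hx
  | some a =>
    obtain ⟨g, ρ₁'', hs, hg, hρ₁⟩ := hN.move none a ha
    change Q.automaton.Step q ρ₁ g (a.eval ν) q' ρ₁'' at hs
    obtain ⟨p', ρ₂', hw, hR'⟩ := hcov q p ρ₁ ρ₂ g _ q' ρ₁'' hρQ hst₀ hs
    by_cases hne : a = Act.tau 𝔸
    · subst hne
      obtain ⟨hres, hV⟩ := hobs₂ V hVSV j₀ hj₀ ha
      have hname : ∀ i, name i ≠ j₀ := fun i hi => by
        have : (some i : Option I) = none := hwf.2.1 hi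
        simp at this
      have hl : l = 𝔸.groundTau := by rw [hN.lab, hres, Act.eval_tau]
      subst hl
      have hstay := fun i => hN.stay (some i) (hV _ (hname i))
      have hss : s' = s := funext fun i => (hstay i).1
      subst hss
      -- Nothing but the filling moves, so all hole actions of the node come from `Q`.
      have hfg : f = g := by
        funext j
        by_cases hj : j ∈ Q.holes
        · exact hg j hj
        rw [hs.eq_none_of_notMem_holes hj]
        by_cases hjJ : j ∈ J \ {j₀}
        · rw [hN.act_hole j hjJ, hV j hjJ.2, Option.map_none]
        by_cases hji : ∃ i, j ∈ (sub i).holes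
        · obtain ⟨i, hi⟩ := hji
          exact (hstay i).2.1 j hi
        · refine hN.act_none j hjJ ?_
          rintro (_ | i)
          · exact hj
          · exact fun hi => hji ⟨i, hi⟩
      subst hfg
      refine ⟨fillState p' s', ρ₂', hwf'.groundWeak_fill_tau hVSV₀ hV₀j₀ hV₀ hres₀ hguard₀ hw rfl
        s', fun _ => rfl, fun i x hx => ?_, ?_⟩
      · rw [hw.eq_of_notMem_vars (Set.disjoint_left.1 (hvars₂ i) hx), ← hρsub i x hx]
        exact (hstay i).2.2 x hx
      · exact (hR _ _ _ _ _ _ (fun x hx => (hρ₁ x hx).symm) fun x _ => rfl).1 hR'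
    · obtain ⟨κ', hw', e₁, e₂⟩ := hwf'.groundWeak_fill hVSV₀ hV₀j₀ hV₀ hres₀ hguard₀ hQ hVSV hN
        ha hne hw rfl (κ := ρ₂) (fun _ _ => rfl) fun i x hx => (hρsub i x hx).symm
      refine ⟨fillState p' s', κ', ?_, fun _ => rfl, fun i x hx => (e₂ i x hx).symm, ?_⟩
      · have hf : (fun j => if j ∈ Q'.holes then groundVis (g j) else groundVis (f j)) =
            fun j => groundVis (f j) := funext fun j => by
          split_ifs with hj
          · rw [hg j (by rw [← hQ] at hj; exact hj)]
          · rfl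
        rwa [hf] at hw'
      · exact (hR _ _ _ _ _ _ (fun x hx => (hρ₁ x hx).symm) fun x hx => (e₁ x hx).symm).1 hR'

end PNet

/-! ### The congruence theorem -/

theorem mainTheorem4 {𝔸 : TermAlgebra.{u}} {ι : Type w}
    (P Q Q' : PNet.{u, v, w} 𝔸 ι) (j₀ : ι)
    (hP : P.WF) (hPQ : (P.fill j₀ Q).WF) (hPQ' : (P.fill j₀ Q').WF)
    (hobs : P.CannotObserveSilent) (hj₀ : j₀ ∈ P.rootHoles)
    (hQ : Q.outSort = P.holeSort j₀) (hQ' : Q'.outSort = P.holeSort j₀)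
    (hbis : Q.WeakFHBisimilar Q') :
    (P.fill j₀ Q).WeakFHBisimilar (P.fill j₀ Q') := by
  cases P with
  | leaf L => exact absurd hj₀ (Set.notMem_empty j₀)
  | node I name sub J sort SV =>
    obtain ⟨hholes, hsort, R, ⟨hR, hc, hc'⟩, hinit⟩ := hbis
    change Q.holes = Q'.holes at hholes
    refine ⟨?_, fun j _ => ?_, PNet.fillRel R, ⟨?_, ?_, ?_⟩, fun ρ => ?_⟩
    · change (PNet.fill _ _ _).holes = (PNet.fill _ _ _).holes
      rw [PNet.holes_fill, PNet.holes_fill, hholes]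
    · change (PNet.fill _ _ _).holeSort j = (PNet.fill _ _ _).holeSort j
      rw [PNet.holeSort_fill, PNet.holeSort_fill]
      have : ∀ sg, (j ∈ Q.holes ∧ sg ∈ Q.holeSort j) ↔ (j ∈ Q'.holes ∧ sg ∈ Q'.holeSort j) :=
        fun sg => by
          rw [← hholes]
          exact and_congr_right fun hj => by
            rw [show Q.holeSort j = Q'.holeSort j from hsort j hj]
      simp only [this]
    · intro s t ρ₁ ρ₁' ρ₂ ρ₂' h₁ h₂
      change ∀ x ∈ (PNet.fill _ _ _).vars, _ at h₁ h₂
      rw [PNet.vars_fill] at h₁ h₂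
      have e₁ : ∀ i, ∀ x ∈ (sub i).vars, ρ₁ x = ρ₁' x :=
        fun i x hx => h₁ x (Or.inr (Set.mem_iUnion.2 ⟨i, hx⟩))
      have e₂ : ∀ i, ∀ x ∈ (sub i).vars, ρ₂ x = ρ₂' x :=
        fun i x hx => h₂ x (Or.inr (Set.mem_iUnion.2 ⟨i, hx⟩))
      refine and_congr_right fun _ => and_congr ?_
        (hR _ _ _ _ _ _ (fun x hx => h₁ x (Or.inl hx)) fun x hx => h₂ x (Or.inl hx))
      exact forall_congr' fun i => forall₂_congr fun x hx => by rw [e₁ i x hx, e₂ i x hx]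
    · exact PNet.weaklyCovered_fill hPQ hPQ' hobs hj₀ hholes hR hc
    -- The hypotheses are symmetric in the two fillings, and the relation induced by the converse of
    -- `R` is the converse of the induced one, up to the orientation of the equations on the
    -- context.
    · have := PNet.weaklyCovered_fill hPQ' hPQ hobs hj₀ hholes.symm
        (R := fun t s ρ₂ ρ₁ => R s t ρ₁ ρ₂) (fun s t ρ₁ ρ₁' ρ₂ ρ₂' h₁ h₂ => hR _ _ _ _ _ _ h₂ h₁)
        hc'
      convert this using 1
      funext t s ρ₂ ρ₁
      exact propext
        ⟨fun ⟨h₁, h₂, h₃⟩ => ⟨fun i => (h₁ i).symm, fun i x hx => (h₂ i x hx).symm, h₃⟩,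
          fun ⟨h₁, h₂, h₃⟩ => ⟨fun i => (h₁ i).symm, fun i x hx => (h₂ i x hx).symm, h₃⟩⟩
    · exact ⟨fun _ => rfl, fun _ _ _ => rfl, hinit ρ⟩
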